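/- Let $[t_0,t_f]\subset\mathbb{R}$ with $t_0<t_f$, let $\mathcal{W}$ be a finite set of origin-destination pairs, and let $\mathcal{P}$ be a finite set of paths, partitioned into the nonempty sets $\mathcal{P}_{ij}$ of paths connecting $(i,j)\in\mathcal{W}$. Let $Q_{ij}\ge 0$ be fixed travel demands, and let $$\Lambda_0=\Big\{h=(h_p)_{p\in\mathcal{P}}\in (L^2[t_0,t_f])^{|\mathcal{P}|}:\ h_p\ge 0 \text{ a.e. for all } p\in\mathcal{P},\ \ \sum_{p\in\mathcal{P}_{ij}}\int_{t_0}^{t_f}h_p(t)\,dt=Q_{ij}\ \ \forall (i,j)\in\mathcal{W}\Big\}.$$ For $p\in\mathcal{P}$, $t\in[t_0,t_f]$ and $h\in\Lambda_0$ let $\Psi_p(t,h)\ge 0$ be the effective delay on path $p$ at departure time $t$, with $\Psi_p(\cdot,h)$ square integrable, and for $p\in\mathcal{P}_{ij}$ let $\varepsilon^p_{ij}:\Lambda_0\to\mathbb{R}_+$ be the tolerances. Put $$v_{ij}(h)=\min_{p\in\mathcal{P}_{ij}}\ \operatorname*{ess\,inf}_{t\in[t_0,t_f]}\Psi_p(t,h).$$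 Assume that 1. the operator $\Psi:\Lambda_0\to (L^2_+[t_0,t_f])^{|\mathcal{P}|}$, $h\mapsto(\Psi_p(\cdot,h))_{p\in\mathcal{P}}$, is continuous for the $L^2$ norm; 2. $\Psi_p(t,h)$ is Lipschitz continuous in $t$, uniformly in $h$: for every $p\in\mathcal{P}$ there is $L_p\ge 0$ such that $|\Psi_p(t,h)-\Psi_p(s,h)|\le L_p|t-s|$ for all $s,t\in[t_0,t_f]$ and all $h\in\Lambda_0$; 3. there is $\varepsilon^{min}>0$ such that $\varepsilon^p_{ij}(h)\ge\varepsilon^{min}$ for all $(i,j)\in\mathcal{W}$, $p\in\mathcal{P}_{ij}$ and $h\in\Lambda_0$. Then a variable-tolerance bounded-rationality dynamic user equilibrium with simultaneous route-and-departure choice (VT-BR-DUE) exists: there is $h^*\in\Lambda_0$ such that for all $(i,j)\in\mathcal{W}$, all $p\in\mathcal{P}_{ij}$ and almost every $t\in[t_0,t_f]$, $$h^*_p(t)>0\ \Longrightarrow\ v_{ij}(h^*)\le\Psi_p(t,h^*)\le v_{ij}(h^*)+\varepsilon^p_{ij}(h^*).$$ -/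

import Mathlib

open MeasureTheory

/-- Lebesgue measure on the analysis period `[t₀, tf]`. -/
noncomputable abbrev dayMeasure (t₀ tf : ℝ) : Measure ℝ :=
  volume.restrict (Set.Icc t₀ tf)

/-- The Hilbert space `(L²[t₀, tf])^|P|`, with norm `‖u‖² = ∑ p, ∫ |u p|²`. -/
abbrev PathSpace (P : Type*) (t₀ tf : ℝ) : Type _ :=
  PiLp 2 (fun _ : P => Lp ℝ 2 (dayMeasure t₀ tf))

/-- The set `Λ₀` of feasible path flows (departure rates). Here `od p` is the origin-destination
pair connected by the path `p` (so that the paths serving `w` are those with `od p = w`), and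
`Q w` is the fixed travel demand of the pair `w`. -/
def feasibleFlows {P W : Type*} [Fintype P] [DecidableEq W] (t₀ tf : ℝ) (od : P → W)
    (Q : W → ℝ) : Set (PathSpace P t₀ tf) :=
  {h | (∀ p, ∀ᵐ t ∂(dayMeasure t₀ tf), 0 ≤ h p t) ∧
    ∀ w, ∑ p with od p = w, ∫ t in Set.Icc t₀ tf, h p t = Q w}

section Equilibrium

variable {P W : Type*} [Fintype P] [DecidableEq W] {t₀ tf : ℝ} {od : P → W} {Q : W → ℝ}

/-- The operator `h ↦ (Ψ p · h)_p` from `Λ₀` to `(L²[t₀, tf])^|P|` given by square-integrable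
effective delays `Ψ p t h` (path `p`, departure time `t`, path flows `h`). -/
noncomputable def delayOperator (Ψ : P → ℝ → feasibleFlows t₀ tf od Q → ℝ)
    (hΨ : ∀ p h, MemLp (fun t => Ψ p t h) 2 (dayMeasure t₀ tf)) :
    feasibleFlows t₀ tf od Q → PathSpace P t₀ tf :=
  fun h => WithLp.toLp 2 (fun p => (hΨ p h).toLp (fun t => Ψ p t h))

/-- `v_p(h)`: the essential infimum over departure times of the effective delay on path `p`. -/
noncomputable def minPathDelay (Ψ : P → ℝ → feasibleFlows t₀ tf od Q → ℝ) (p : P)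
    (h : feasibleFlows t₀ tf od Q) : ℝ :=
  essInf (fun t => Ψ p t h) (dayMeasure t₀ tf)

/-- `v_ij(h)`: the minimum of `v_p(h)` over the (finitely many) paths `p` connecting the
origin-destination pair `w`. -/
noncomputable def minODDelay (Ψ : P → ℝ → feasibleFlows t₀ tf od Q → ℝ) (w : W)
    (h : feasibleFlows t₀ tf od Q) : ℝ :=
  ⨅ p : {p : P // od p = w}, minPathDelay Ψ p.1 h

/-- `h ∈ Λ₀` is a bounded rationality dynamic user equilibrium with variable tolerance `ε` and
simultaneous route-and-departure choice (VT-BR-DUE). -/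
def IsVTBRDUE (Ψ : P → ℝ → feasibleFlows t₀ tf od Q → ℝ)
    (ε : P → feasibleFlows t₀ tf od Q → ℝ) (h : feasibleFlows t₀ tf od Q) : Prop :=
  ∀ w : W, ∀ p : P, od p = w → ∀ᵐ t ∂(dayMeasure t₀ tf), 0 < h.1 p t →
    Ψ p t h ∈ Set.Icc (minODDelay Ψ w h) (minODDelay Ψ w h + ε p h)

end Equilibrium

/-! ### No C¹ retraction of a ball onto its sphere. -/

section Brouwer

open Metric Set

/-! A positive tolerance floor leaves room for discretization, so no compactness of Λ₀ is needed.
Cut the day into finitely many short cells and allow only flows that are combinations of uniform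
densities on cells. An alternative is then a pair (path, cell), its cost is the average delay over
the cell, and `exists_finite_equilibrium` gives masses that use only cheapest alternatives. By the
Lipschitz bound (`abs_setAverage_sub_le`), averages differ from pointwise delays by at most `L * η`,
so a used departure time is within `2 * (L * η) ≤ εmin` of optimal among all paths and times.

The finite equilibrium solves a variational inequality, obtained from Brouwer's theorem and
projection onto a convex set. Brouwer rests on `not_exists_contDiff_retraction_sphere`, proved by
comparing volumes along the homotopy from the identity to a retraction. -/

/-- The determinant is a polynomial in `t` of degree at most `finrank`, so `finrank + 1` small nodes
determine its value at 1. The Lagrange weights do not depend on `A`, so the identity can be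
integrated over a family of operators. -/
theorem exists_weights_det_one_add {E : Type*} [NormedAddCommGroup E] [NormedSpace ℝ E]
    [FiniteDimensional ℝ E] {δ : ℝ} (hδ : 0 < δ) :
    ∃ (s : Finset ℝ) (w : ℝ → ℝ), (∀ t ∈ s, t ∈ Ioo 0 δ) ∧ ∀ A : E →L[ℝ] E,
      (1 + A).det = ∑ t ∈ s, w t * (1 + t • A).det := by
  classical
  obtain ⟨s, hs, hcard⟩ := (Ioo_infinite hδ).exists_subset_card_eq (Module.finrank ℝ E + 1)
  refine ⟨s, fun t => (Lagrange.basis s id t).eval 1, fun t ht => hs ht, fun A => ?_⟩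
  let b := Module.finBasis ℝ E
  let M := LinearMap.toMatrix b b (A : E →ₗ[ℝ] E)
  let p : Polynomial ℝ := ((Polynomial.X : Polynomial ℝ) • M.map Polynomial.C +
    (1 : Matrix _ _ ℝ).map Polynomial.C).det
  have hp : ∀ t : ℝ, p.eval t = (1 + t • A).det := by
    intro t
    have h1 : (1 + t • A).det = LinearMap.det ((1 + t • A : E →L[ℝ] E) : E →ₗ[ℝ] E) := rfl
    rw [h1, ← LinearMap.det_toMatrix b]
    have h2 : p.eval t = (Polynomial.evalRingHom t) p := rfl
    rw [h2, RingHom.map_det]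
    congr 1
    ext i j
    simp [M, Matrix.one_apply, LinearMap.toMatrix_apply, add_comm, Finsupp.single_apply]
    split_ifs <;> simp_all [mul_comm]
  have hdeg : p.degree < s.card := by
    rw [hcard]
    refine lt_of_le_of_lt Polynomial.degree_le_natDegree ?_
    have := Polynomial.natDegree_det_X_add_C_le M 1
    rw [Fintype.card_fin] at this
    exact_mod_cast Nat.lt_succ_of_le this
  have h := congrArg (Polynomial.eval 1) (Lagrange.eq_interpolate (v := id)
    (Function.injective_id.injOn) hdeg)
  rw [hp, one_smul, Lagrange.interpolate_apply, Polynomial.eval_finsetSum] at h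
  rw [h]
  refine Finset.sum_congr rfl fun t _ => ?_
  rw [Polynomial.eval_mul, Polynomial.eval_C, id, hp, mul_comm]

theorem range_eq_top_of_det_ne_zero {E : Type*} [NormedAddCommGroup E] [NormedSpace ℝ E]
    [FiniteDimensional ℝ E] {A : E →L[ℝ] E} (hA : A.det ≠ 0) : A.range = ⊤ := by
  have h : IsUnit (LinearMap.det (A : E →ₗ[ℝ] E)) := isUnit_iff_ne_zero.2 hA
  exact LinearMap.range_eq_top.2 fun y =>
    ⟨(LinearMap.equivOfIsUnitDet h).symm y, by
      rw [← LinearMap.equivOfIsUnitDet_apply h, LinearEquiv.apply_symm_apply]⟩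

variable {E : Type*} [NormedAddCommGroup E] [InnerProductSpace ℝ E] [FiniteDimensional ℝ E]

/-- The image is open by the inverse function theorem. It is also relatively closed in the ball: the
image of the closed ball is compact, and sphere points are fixed, so they contribute nothing inside.
Connectedness finishes. -/
theorem image_ball_eq_of_perturbation {R t : ℝ} (ht : t ∈ Ioo (0 : ℝ) 1)
    {r : E → E} (hr : ∀ x ∈ closedBall (0 : E) R, ContDiffAt ℝ 1 r x)
    (hfix : ∀ x, ‖x‖ = R → r x = x) (hval : ∀ x ∈ closedBall (0 : E) R, ‖r x‖ = R)
    (hdet : ∀ x ∈ ball (0 : E) R, 0 < (1 + t • (fderiv ℝ r x - 1)).det) :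
    (fun x => x + t • (r x - x)) '' ball 0 R = ball 0 R := by
  rcases le_or_gt R 0 with hR | hR
  · simp [ball_eq_empty.2 hR]
  set f : E → E := fun x => x + t • (r x - x) with hf
  have hmaps : ∀ x ∈ ball (0 : E) R, f x ∈ ball (0 : E) R := by
    intro x hx
    have h1 := hval x (ball_subset_closedBall hx)
    rw [mem_ball_zero_iff] at hx ⊢
    have h2 : f x = (1 - t) • x + t • r x := by simp only [hf]; module
    rw [h2]
    calc ‖(1 - t) • x + t • r x‖ ≤ (1 - t) * ‖x‖ + t * ‖r x‖ := by
          refine (norm_add_le _ _).trans_eq ?_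
          rw [norm_smul, norm_smul, Real.norm_of_nonneg ht.1.le,
            Real.norm_of_nonneg (sub_nonneg.2 ht.2.le)]
      _ < R := by rw [h1]; nlinarith [ht.2, ht.1]
  have hcont : ContinuousOn f (closedBall 0 R) := by
    have : ContinuousOn r (closedBall 0 R) := fun x hx =>
      (hr x hx).continuousAt.continuousWithinAt
    fun_prop
  have hopen : IsOpen (f '' ball 0 R) := by
    rw [isOpen_iff_mem_nhds]
    rintro _ ⟨x, hx, rfl⟩
    have h1 : HasStrictFDerivAt f (1 + t • (fderiv ℝ r x - 1)) x := by
      have := (hr x (ball_subset_closedBall hx)).hasStrictFDerivAt one_ne_zero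
      exact (hasStrictFDerivAt_id x).add ((this.sub (hasStrictFDerivAt_id x)).const_smul t)
    have h2 : (1 + t • (fderiv ℝ r x - 1)).range = ⊤ := by
      exact range_eq_top_of_det_ne_zero (hdet x hx).ne'
    rw [← h1.map_nhds_eq_of_surj h2]
    exact Filter.image_mem_map (isOpen_ball.mem_nhds hx)
  have hclosed : f '' ball 0 R = f '' closedBall 0 R ∩ ball 0 R := by
    apply Subset.antisymm
    · rintro _ ⟨x, hx, rfl⟩
      exact ⟨⟨x, ball_subset_closedBall hx, rfl⟩, hmaps x hx⟩
    · rintro _ ⟨⟨x, hx, rfl⟩, hfx⟩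
      refine ⟨x, ?_, rfl⟩
      rw [mem_closedBall_zero_iff] at hx
      rw [mem_ball_zero_iff] at hfx ⊢
      refine lt_of_le_of_ne hx fun h => ?_
      simp [hf, hfix x h, h] at hfx
  have hcl : IsClosed (f '' closedBall 0 R) :=
    ((isCompact_closedBall 0 R).image_of_continuousOn hcont).isClosed
  refine Subset.antisymm (image_subset_iff.2 hmaps) ?_
  have hpre : IsPreconnected (ball (0 : E) R) := (convex_ball 0 R).isPreconnected
  refine hpre.subset_of_closure_inter_subset hopen ?_ ?_
  · exact ⟨f 0, hmaps 0 (mem_ball_self hR), mem_image_of_mem _ (mem_ball_self hR)⟩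
  · rintro x ⟨hx, hxb⟩
    rw [hclosed]
    exact ⟨closure_minimal (image_mono ball_subset_closedBall) hcl hx, hxb⟩

variable [MeasurableSpace E] [BorelSpace E]

theorem integral_det_perturbation_eq {R : ℝ}
    {r : E → E} (hr : ∀ x ∈ closedBall (0 : E) R, ContDiffAt ℝ 1 r x)
    (hfix : ∀ x, ‖x‖ = R → r x = x) (hval : ∀ x ∈ closedBall (0 : E) R, ‖r x‖ = R) :
    ∃ δ > 0, ∀ t ∈ Ioo (0 : ℝ) δ,
      ∫ x in ball (0 : E) R, (1 + t • (fderiv ℝ r x - 1)).det = volume.real (ball (0 : E) R) := by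
  have hA : ContinuousOn (fun x => fderiv ℝ r x - 1) (closedBall 0 R) := by
    intro x hx
    have := ((hr x hx).fderiv_right (m := 0) (by norm_num)).continuousAt
    exact (this.sub continuousAt_const).continuousWithinAt
  obtain ⟨C, hC⟩ := (isCompact_closedBall (0 : E) R).exists_bound_of_continuousOn hA
  set K : ℝ := max C 0 + 1
  have hK : 0 < K := by positivity
  have hCK : ∀ x ∈ closedBall (0 : E) R, ‖fderiv ℝ r x - 1‖ ≤ K := fun x hx =>
    (hC x hx).trans ((le_max_left _ _).trans (le_add_of_nonneg_right zero_le_one))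
  obtain ⟨η, hη, hdet⟩ : ∃ η > 0, ∀ B : E →L[ℝ] E, ‖B‖ < η → 0 < (1 + B).det := by
    have h1 : Filter.Tendsto (fun B : E →L[ℝ] E => (1 + B).det) (nhds 0) (nhds 1) := by
      have : Continuous fun B : E →L[ℝ] E => (1 + B).det :=
        ContinuousLinearMap.continuous_det.comp (by fun_prop)
      have h0 := this.tendsto 0
      have h2 : ((1 : E →L[ℝ] E) + 0).det = 1 := by
        rw [add_zero]; exact LinearMap.det_id
      rwa [h2] at h0
    obtain ⟨η, hη, h⟩ := Metric.eventually_nhds_iff.1 (h1.eventually (lt_mem_nhds zero_lt_one))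
    exact ⟨η, hη, fun B hB => h (by simpa using hB)⟩
  -- The three bounds give, in turn: the ball is mapped into itself, the map is injective (`t * K <
  -- 1`), and the determinant is positive.
  refine ⟨min 1 (min (1 / K) (η / K)), by positivity, fun t ht => ?_⟩
  obtain ⟨ht0, ht1⟩ := ht
  have ht2 : t < 1 := ht1.trans_le (min_le_left _ _)
  have ht3 : t * K < 1 :=
    (lt_div_iff₀ hK).1 (ht1.trans_le ((min_le_right _ _).trans (min_le_left _ _)))
  have ht4 : t * K < η :=
    (lt_div_iff₀ hK).1 (ht1.trans_le ((min_le_right _ _).trans (min_le_right _ _)))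
  have hpos : ∀ x ∈ ball (0 : E) R, 0 < (1 + t • (fderiv ℝ r x - 1)).det := by
    intro x hx
    refine hdet _ ?_
    rw [norm_smul, Real.norm_of_nonneg ht0.le]
    exact (mul_le_mul_of_nonneg_left (hCK x (ball_subset_closedBall hx)) ht0.le).trans_lt ht4
  have himg := image_ball_eq_of_perturbation ⟨ht0, ht2⟩ hr hfix hval hpos
  have hg : ∀ x ∈ ball (0 : E) R, HasFDerivAt (fun x => r x - x) (fderiv ℝ r x - 1) x :=
    fun x hx => (((hr x (ball_subset_closedBall hx)).differentiableAt one_ne_zero).hasFDerivAt).sub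
      (hasFDerivAt_id x)
  have hinj : InjOn (fun x => x + t • (r x - x)) (ball 0 R) := by
    intro x hx y hy hxy
    have h1 := (convex_ball (0 : E) R).norm_image_sub_le_of_norm_hasFDerivWithin_le
      (fun z hz => (hg z hz).hasFDerivWithinAt)
      (fun z hz => hCK z (ball_subset_closedBall hz)) hx hy
    have h2 : x - y = t • ((r y - y) - (r x - x)) := by
      simp only at hxy
      rw [smul_sub, sub_eq_sub_iff_add_eq_add, hxy, add_comm]
    have h3 : ‖x - y‖ ≤ (t * K) * ‖x - y‖ := by
      conv_lhs => rw [h2, norm_smul, Real.norm_of_nonneg ht0.le]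
      rw [mul_assoc, norm_sub_rev x y]
      exact mul_le_mul_of_nonneg_left h1 ht0.le
    have h4 : ‖x - y‖ = 0 := by nlinarith [norm_nonneg (x - y)]
    exact sub_eq_zero.1 (norm_eq_zero.1 h4)
  have hcv := integral_image_eq_integral_abs_det_fderiv_smul (volume : Measure E)
    (measurableSet_ball (x := (0 : E)) (ε := R))
    (fun x hx => ((hasFDerivAt_id x).add ((hg x hx).const_smul t)).hasFDerivWithinAt) hinj
    (fun _ => (1 : ℝ))
  have himg' : (id + t • fun x => r x - x) '' ball 0 R = ball 0 R := himg
  rw [himg'] at hcv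
  rw [setIntegral_const, smul_eq_mul, mul_one] at hcv
  rw [hcv]
  refine setIntegral_congr_fun measurableSet_ball fun x hx => ?_
  simp only [smul_eq_mul, mul_one]
  exact (abs_of_pos (hpos x hx)).symm

/-- Extrapolating the volume identity from small `t` to `t = 1` makes the integral of `det (fderiv ℝ
r x)` the volume of the ball, yet a map into the sphere has singular derivative. -/
theorem not_exists_contDiff_retraction_sphere {R : ℝ} (hR : 0 < R)
    {r : E → E} (hr : ∀ x ∈ closedBall (0 : E) R, ContDiffAt ℝ 1 r x)
    (hfix : ∀ x, ‖x‖ = R → r x = x) (hval : ∀ x ∈ closedBall (0 : E) R, ‖r x‖ = R) : False := by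
  obtain ⟨δ, hδ, hint⟩ := integral_det_perturbation_eq hr hfix hval
  obtain ⟨s, w, hs, hw⟩ := exists_weights_det_one_add (E := E) hδ
  have hA : ContinuousOn (fun x => fderiv ℝ r x) (closedBall 0 R) := fun x hx =>
    ((hr x hx).fderiv_right (m := 0) (by norm_num)).continuousAt.continuousWithinAt
  have hintble : ∀ t : ℝ, IntegrableOn (fun x => (1 + t • (fderiv ℝ r x - 1)).det)
      (ball (0 : E) R) := fun t => by
    refine IntegrableOn.mono_set (ContinuousOn.integrableOn_compact
      (isCompact_closedBall 0 R) ?_) ball_subset_closedBall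
    exact ContinuousLinearMap.continuous_det.comp_continuousOn (by fun_prop)
  have hone : ∑ t ∈ s, w t = 1 := by
    have h := hw 0
    have h1 : (1 : E →L[ℝ] E).det = 1 := LinearMap.det_id
    simp only [add_zero, smul_zero, h1, mul_one] at h
    exact h.symm
  have h1 : ∫ x in ball (0 : E) R, (1 + (fderiv ℝ r x - 1)).det =
      volume.real (ball (0 : E) R) := by
    rw [funext fun x => hw (fderiv ℝ r x - 1), integral_finsetSum _ fun t _ => (hintble t).const_mul _]
    rw [Finset.sum_congr rfl fun t ht => by rw [integral_const_mul, hint t (hs t ht)]]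
    rw [← Finset.sum_mul, hone, one_mul]
  have h2 : ∫ x in ball (0 : E) R, (1 + (fderiv ℝ r x - 1)).det = 0 := by
    refine setIntegral_eq_zero_of_forall_eq_zero fun x hx => ?_
    rw [add_sub_cancel]
    by_contra hne
    have hd : HasFDerivAt r (fderiv ℝ r x) x :=
      ((hr x (ball_subset_closedBall hx)).differentiableAt one_ne_zero).hasFDerivAt
    -- Were the derivative onto, it would hit the radial vector `r x`, whereas differentiating the
    -- constant `‖r y‖ ^ 2` shows that its range is orthogonal to `r x`.
    obtain ⟨v, hv⟩ := LinearMap.range_eq_top.1 (range_eq_top_of_det_ne_zero hne) (r x)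
    have hc : (fun y => ‖r y‖ ^ 2) =ᶠ[nhds x] fun _ => R ^ 2 := by
      filter_upwards [isOpen_ball.mem_nhds hx] with y hy
      rw [hval y (ball_subset_closedBall hy)]
    have h0 := (hd.norm_sq.congr_of_eventuallyEq hc.symm).unique (hasFDerivAt_const (R ^ 2) x)
    have h3 := DFunLike.congr_fun h0 v
    have hv' : fderiv ℝ r x v = r x := hv
    simp [hv'] at h3
    have := hval x (ball_subset_closedBall hx)
    simp [h3] at this
    exact hR.ne this
  have h3 : 0 < volume.real (ball (0 : E) R) :=
    ENNReal.toReal_pos (measure_ball_pos volume 0 hR).ne' measure_ball_lt_top.ne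
  linarith

end Brouwer

/-! ### Brouwer, variational inequalities and finite equilibria. -/

section FixedPoint

open Metric Set

theorem exists_contDiff_retraction_sphere {E : Type*} [NormedAddCommGroup E]
    [InnerProductSpace ℝ E] {R : ℝ} {p : E → E} (hp : ContDiff ℝ 1 p)
    (hpR : ∀ x, ‖p x‖ < R) (hne : ∀ x ∈ closedBall (0 : E) R, p x ≠ x) :
    ∃ r : E → E, (∀ x ∈ closedBall (0 : E) R, ContDiffAt ℝ 1 r x) ∧
      (∀ x, ‖x‖ = R → r x = x) ∧ ∀ x ∈ closedBall (0 : E) R, ‖r x‖ = R := by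
  have hR : 0 < R := (norm_nonneg _).trans_lt (hpR 0)
  let u : E → E := fun x => x - p x
  -- The ray from `p x` through `x` meets the sphere at `x + l x • u x`, where `l x` is the larger
  -- root of a quadratic with quarter discriminant `D x`. Positivity of `D` keeps the square root
  -- smooth.
  let D : E → ℝ := fun x => inner ℝ x (u x) ^ 2 + ‖u x‖ ^ 2 * (R ^ 2 - ‖x‖ ^ 2)
  let l : E → ℝ := fun x => (-inner ℝ x (u x) + √(D x)) / ‖u x‖ ^ 2
  have hu : ∀ x ∈ closedBall (0 : E) R, 0 < ‖u x‖ := fun x hx =>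
    norm_pos_iff.2 (sub_ne_zero.2 (hne x hx).symm)
  have hin : ∀ x, ‖x‖ = R → 0 < inner ℝ x (u x) := by
    intro x hx
    have h1 : inner ℝ x (p x) < R ^ 2 := by
      refine (real_inner_le_norm _ _).trans_lt ?_
      rw [hx, sq]
      exact mul_lt_mul_of_pos_left (hpR x) hR
    have h2 : inner ℝ x (u x) = R ^ 2 - inner ℝ x (p x) := by
      rw [inner_sub_right, real_inner_self_eq_norm_sq, hx]
    rw [h2]
    linarith
  have hD : ∀ x ∈ closedBall (0 : E) R, 0 < D x := by
    intro x hx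
    have hxu := hu x hx
    rw [mem_closedBall_zero_iff] at hx
    rcases hx.lt_or_eq with h | h
    · have : 0 < R ^ 2 - ‖x‖ ^ 2 := by nlinarith [norm_nonneg x]
      positivity
    · have := hin x h
      simp only [D, h, sub_self, mul_zero, add_zero]
      positivity
  have hcu : ContDiff ℝ 1 u := contDiff_id.sub hp
  refine ⟨fun x => x + l x • u x, fun x hx => ?_, fun x hx => ?_, fun x hx => ?_⟩
  · have hi : ContDiff ℝ 1 fun x => inner ℝ x (u x) := contDiff_id.inner ℝ hcu
    have hn : ContDiff ℝ 1 fun x => ‖u x‖ ^ 2 := hcu.norm_sq ℝ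
    have hDc : ContDiff ℝ 1 D :=
      (hi.pow 2).add (hn.mul (contDiff_const.sub (contDiff_id.norm_sq ℝ)))
    have hl : ContDiffAt ℝ 1 l x :=
      (hi.contDiffAt.neg.add (hDc.contDiffAt.sqrt (hD x hx).ne')).div hn.contDiffAt
        (pow_pos (hu x hx) 2).ne'
    exact contDiffAt_id.add (hl.smul hcu.contDiffAt)
  · have h1 : √(D x) = inner ℝ x (u x) := by
      simp only [D, hx, sub_self, mul_zero, add_zero]
      exact Real.sqrt_sq (hin x hx).le
    simp [l, h1]
  · have hs := Real.sq_sqrt (hD x hx).le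
    have hxu := (hu x hx).ne'
    have h1 : ‖x + l x • u x‖ ^ 2 = R ^ 2 := by
      rw [norm_add_sq_real, norm_smul, inner_smul_right, mul_pow, Real.norm_eq_abs, sq_abs]
      simp only [l]
      field_simp
      simp only [D] at hs ⊢
      linear_combination hs
    exact (sq_eq_sq₀ (norm_nonneg _) hR.le).1 h1

variable {E : Type*} [NormedAddCommGroup E] [InnerProductSpace ℝ E] [FiniteDimensional ℝ E]

/-- Brouwer's fixed point theorem, for continuous maps with bounded range. -/
theorem exists_fixedPoint_of_bounded {f : E → E} (hf : Continuous f) {C : ℝ}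
    (hC : ∀ x, ‖f x‖ ≤ C) : ∃ x, f x = x := by
  borelize E
  by_contra! hne
  obtain ⟨δ, hδ, hδf⟩ : ∃ δ > 0, ∀ x ∈ closedBall (0 : E) (C + 1), δ ≤ ‖x - f x‖ := by
    have hpos : 0 ≤ C + 1 := by linarith [(norm_nonneg _).trans (hC 0)]
    obtain ⟨x, -, hx⟩ := (isCompact_closedBall (0 : E) (C + 1)).exists_isMinOn
      (nonempty_closedBall.2 hpos) (f := fun x => ‖x - f x‖) (by fun_prop)
    exact ⟨_, norm_pos_iff.2 (sub_ne_zero.2 (hne x).symm), fun y hy => hx hy⟩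
  -- An error below `δ` creates no fixed point; an error below 1 keeps `p` inside radius `C + 1`.
  obtain ⟨p, hp, hpf, -⟩ := hf.exists_contDiff_approx (ε := fun _ => min δ 1) 1
    continuous_const fun _ => lt_min hδ one_pos
  obtain ⟨r, h1, h2, h3⟩ := exists_contDiff_retraction_sphere (R := C + 1) (p := p)
    (by exact_mod_cast hp)
    (fun x => by
      have := (hpf x).trans_le (min_le_right _ _)
      rw [dist_eq_norm] at this
      linarith [hC x, norm_sub_norm_le (p x) (f x)])
    (fun x hx h => by
      have := (hpf x).trans_le (min_le_left _ _)
      rw [dist_eq_norm, h] at this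
      exact this.not_ge (hδf x hx))
  exact not_exists_contDiff_retraction_sphere
    (by linarith [(norm_nonneg _).trans (hC 0)]) h1 h2 h3

/-- Adding the obtuse-angle inequalities at two points shows that the metric projection is
1-Lipschitz. -/
theorem exists_continuous_projection {K : Set E} (hne : K.Nonempty) (hcl : IsClosed K)
    (hK : Convex ℝ K) : ∃ π : E → E, Continuous π ∧ (∀ x, π x ∈ K) ∧
      ∀ x, ∀ y ∈ K, inner ℝ (x - π x) (y - π x) ≤ 0 := by
  choose π hπ hmin using exists_norm_eq_iInf_of_complete_convex hne hcl.isComplete hK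
  have hin : ∀ x, ∀ y ∈ K, inner ℝ (x - π x) (y - π x) ≤ 0 := fun x =>
    (norm_eq_iInf_iff_real_inner_le_zero hK (hπ x)).1 (hmin x)
  refine ⟨π, (LipschitzWith.of_dist_le_mul (K := 1) fun x y => ?_).continuous, hπ, hin⟩
  have h1 := hin x (π y) (hπ y)
  have h2 := hin y (π x) (hπ x)
  have h3 : ‖π x - π y‖ ^ 2 ≤ inner ℝ (x - y) (π x - π y) := by
    have : ‖π x - π y‖ ^ 2 - inner ℝ (x - y) (π x - π y) =
        inner ℝ (x - π x) (π y - π x) + inner ℝ (y - π y) (π x - π y) := by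
      rw [← real_inner_self_eq_norm_sq]
      simp only [inner_sub_left, inner_sub_right]
      ring
    linarith
  have h4 := h3.trans (real_inner_le_norm _ _)
  rw [dist_eq_norm, dist_eq_norm, NNReal.coe_one, one_mul]
  by_contra! h
  nlinarith [norm_nonneg (x - y)]

/-- The Hartman–Stampacchia theorem. -/
theorem exists_variationalInequality_solution {K : Set E} (hne : K.Nonempty) (hcpt : IsCompact K)
    (hK : Convex ℝ K) {c : K → E} (hc : Continuous c) :
    ∃ x : K, ∀ y ∈ K, 0 ≤ inner ℝ (c x) (y - x) := by
  obtain ⟨π, hπ, hmem, hin⟩ := exists_continuous_projection hne hcpt.isClosed hK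
  obtain ⟨C, hC⟩ := hcpt.isBounded.exists_norm_le
  -- The inner `π` extends `c` from `K` to all of `E`. A fixed point lies in `K`, and the
  -- obtuse-angle inequality there is the claim.
  obtain ⟨x, hx⟩ := exists_fixedPoint_of_bounded
    (f := fun x => π (π x - c ⟨π x, hmem x⟩))
    (by fun_prop) (fun x => hC _ (hmem _))
  have hxK : x ∈ K := hx ▸ hmem _
  have hπx : π x = x := by
    have := hin x x hxK
    rw [real_inner_self_eq_norm_sq] at this
    have h0 : ‖x - π x‖ = 0 := by nlinarith [norm_nonneg (x - π x)]
    exact (sub_eq_zero.1 (norm_eq_zero.1 h0)).symm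
  simp only [hπx] at hx
  refine ⟨⟨x, hxK⟩, fun y hy => ?_⟩
  have := hin (x - c ⟨x, hxK⟩) y hy
  rw [hx, sub_sub_cancel_left, inner_neg_left] at this
  linarith

/-- Equilibrium of a finite congestion game with elastic route costs: the populations `w` split
the mass `Q w` among the alternatives `i` with `o i = w`, and only cheapest alternatives are
used. -/
theorem exists_finite_equilibrium {ι W : Type*} [Fintype ι] [DecidableEq W]
    (o : ι → W) (ho : Function.Surjective o) (Q : W → ℝ) (hQ : ∀ w, 0 ≤ Q w)
    (c : {x : EuclideanSpace ℝ ι // (∀ i, 0 ≤ x i) ∧ ∀ w, ∑ i with o i = w, x i = Q w} →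
      EuclideanSpace ℝ ι) (hc : Continuous c) :
    ∃ x, ∀ i j, o i = o j → 0 < x.1 i → c x i ≤ c x j := by
  classical
  set K : Set (EuclideanSpace ℝ ι) :=
    {x | (∀ i, 0 ≤ x i) ∧ ∀ w, ∑ i with o i = w, x i = Q w} with hKdef
  have hcl : IsClosed K := by
    simp only [hKdef, ofPred_and, ofPred_forall]
    refine (isClosed_iInter fun i => isClosed_le continuous_const (by fun_prop)).inter
      (isClosed_iInter fun w => isClosed_eq (by fun_prop) continuous_const)
  have hbd : Bornology.IsBounded K := by
    refine (isBounded_closedBall (x := (0 : EuclideanSpace ℝ ι))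
      (r := √(∑ i, Q (o i) ^ 2))).subset fun x hx => ?_
    rw [mem_closedBall_zero_iff, EuclideanSpace.norm_eq]
    refine Real.sqrt_le_sqrt (Finset.sum_le_sum fun i _ => ?_)
    rw [Real.norm_of_nonneg (hx.1 i), ← hx.2 (o i)]
    exact pow_le_pow_left₀ (hx.1 i)
      (Finset.single_le_sum (f := fun i => x i) (fun j _ => hx.1 j) (by simp)) 2
  have hcv : Convex ℝ K := by
    rintro x hx y hy a b ha hb hab
    refine ⟨fun i => ?_, fun w => ?_⟩
    · have h1 := hx.1 i
      have h2 := hy.1 i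
      simp only [PiLp.add_apply, PiLp.smul_apply, smul_eq_mul]
      positivity
    · simp only [PiLp.add_apply, PiLp.smul_apply, smul_eq_mul]
      rw [Finset.sum_add_distrib, ← Finset.mul_sum, ← Finset.mul_sum, hx.2, hy.2, ← add_mul, hab,
        one_mul]
  have hne : K.Nonempty := by
    choose g hg using ho
    refine ⟨WithLp.toLp 2 fun i => if i = g (o i) then Q (o i) else 0, fun i => ?_, fun w => ?_⟩
    · simp only
      split_ifs
      exacts [hQ _, le_rfl]
    · rw [Finset.sum_eq_single (g w)]
      · simp [hg]
      · intro i hi hne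
        rw [Finset.mem_filter] at hi
        simp [hi.2, hne]
      · simp [hg]
  obtain ⟨x, hx⟩ := exists_variationalInequality_solution hne
    (Metric.isCompact_of_isClosed_isBounded hcl hbd) hcv hc
  refine ⟨x, fun i j hij hi => ?_⟩
  rcases eq_or_ne i j with rfl | hne
  · exact le_rfl
  -- Test the inequality by moving the whole mass of `i` to `j`.
  let v : EuclideanSpace ℝ ι := EuclideanSpace.single j (1 : ℝ) - EuclideanSpace.single i (1 : ℝ)
  have hy : x.1 + x.1 i • v ∈ K := by
    refine ⟨fun k => ?_, fun w => ?_⟩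
    · have h1 := x.2.1 k
      rcases eq_or_ne k i with rfl | hk
      · simp [v, hne]
      · simp only [v, PiLp.add_apply, PiLp.smul_apply, PiLp.sub_apply, PiLp.single_apply,
          hk, if_false, smul_eq_mul]
        split_ifs <;> simp only [sub_zero, mul_zero, mul_one, add_zero, h1]
        linarith [x.2.1 i]
    · have hv : ∑ k with o k = w, v k = 0 := by
        simp only [v, PiLp.sub_apply, PiLp.single_apply, Finset.sum_sub_distrib]
        simp [Finset.sum_ite_eq', hij]
      simp only [PiLp.add_apply, PiLp.smul_apply, smul_eq_mul]
      rw [Finset.sum_add_distrib, ← Finset.mul_sum, hv, mul_zero, add_zero, x.2.2]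
  have h := hx _ hy
  rw [add_sub_cancel_left, inner_smul_right] at h
  have h2 := nonneg_of_mul_nonneg_right h hi
  simp only [v, inner_sub_right, EuclideanSpace.inner_single_right] at h2
  simpa using h2

end FixedPoint

/-! ### Short time cells and averages over them. -/

/-- Cells are closed balls of radius `η / 2` clipped to the day. They may overlap, which is harmless
because step flows simply add up. -/
theorem exists_finite_cover_cells {t₀ tf : ℝ} (ht : t₀ < tf) {η : ℝ} (hη : 0 < η) :
    ∃ (s : Finset ℝ) (I : ℝ → Set ℝ), (∀ k, MeasurableSet (I k)) ∧
      (∀ k, I k ⊆ Set.Icc t₀ tf) ∧ (∀ k ∈ s, dayMeasure t₀ tf (I k) ≠ 0) ∧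
      (∀ k, ∀ x ∈ I k, ∀ y ∈ I k, |x - y| ≤ η) ∧ ∀ t ∈ Set.Icc t₀ tf, ∃ k ∈ s, t ∈ I k := by
  obtain ⟨s, hs, hfin, hcov⟩ := (isCompact_Icc (a := t₀) (b := tf)).finite_cover_balls (half_pos hη)
  let I : ℝ → Set ℝ := fun k => Set.Icc (max t₀ (k - η / 2)) (min tf (k + η / 2))
  have hI : ∀ k, I k ⊆ Set.Icc t₀ tf := fun k =>
    Set.Icc_subset_Icc (le_max_left _ _) (min_le_left _ _)
  refine ⟨hfin.toFinset, I, fun k => measurableSet_Icc, hI, fun k hk => ?_,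
    fun k x hx y hy => ?_, fun t htm => ?_⟩
  · rw [Measure.restrict_apply measurableSet_Icc, Set.inter_eq_left.2 (hI k), Real.volume_Icc]
    have hk' := hs (hfin.mem_toFinset.1 hk)
    refine (ENNReal.ofReal_pos.2 (sub_pos.2 (max_lt (lt_min ht ?_) (lt_min ?_ ?_)))).ne' <;>
      linarith [hk'.1, hk'.2]
  · rw [abs_le]
    have h1 := (le_max_right _ _).trans hx.1
    have h2 := (le_max_right _ _).trans hy.1
    have h3 := hx.2.trans (min_le_right _ _)
    have h4 := hy.2.trans (min_le_right _ _)
    constructor <;> linarith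
  · obtain ⟨k, hk, htk⟩ := Set.mem_iUnion₂.1 (hcov htm)
    rw [Metric.mem_ball, Real.dist_eq, abs_lt] at htk
    exact ⟨k, hfin.mem_toFinset.2 hk, max_le htm.1 (by linarith), le_min htm.2 (by linarith)⟩

/-- A closed ball is convex, so it contains the average of values lying in it. -/
theorem abs_setAverage_sub_le {t₀ tf η : ℝ} {L : NNReal} {f : ℝ → ℝ}
    (hf : LipschitzOnWith L f (Set.Icc t₀ tf)) {J : Set ℝ} (hJm : MeasurableSet J)
    (hJ : J ⊆ Set.Icc t₀ tf)
    (hJ0 : dayMeasure t₀ tf J ≠ 0) (hd : ∀ x ∈ J, ∀ y ∈ J, |x - y| ≤ η) {t : ℝ} (ht : t ∈ J) :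
    |(⨍ s in J, f s ∂(dayMeasure t₀ tf)) - f t| ≤ L * η := by
  have hint : IntegrableOn f J (dayMeasure t₀ tf) :=
    IntegrableOn.integrable (μ := volume)
      (hf.continuousOn.integrableOn_compact isCompact_Icc) |>.integrableOn
  have h := (convex_closedBall (f t) (L * η)).set_average_mem Metric.isClosed_closedBall
    hJ0 (measure_ne_top _ _) ?_ hint
  · rwa [Metric.mem_closedBall, Real.dist_eq] at h
  · filter_upwards [ae_restrict_mem hJm] with s hs
    exact (hf.dist_le_mul s (hJ hs) t (hJ ht)).trans
      (mul_le_mul_of_nonneg_left (hd s hs t ht) L.2)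

/-! ### Bounds for the minimal delays. -/

section

variable {P W : Type*} [Fintype P] [DecidableEq W] {t₀ tf : ℝ} {od : P → W} {Q : W → ℝ}
  {Ψ : P → ℝ → feasibleFlows t₀ tf od Q → ℝ}

theorem dayMeasure_ne_zero (ht : t₀ < tf) : dayMeasure t₀ tf ≠ 0 := by
  rw [Ne, Measure.restrict_eq_zero, Real.volume_Icc]
  exact (ENNReal.ofReal_pos.2 (sub_pos.2 ht)).ne'

theorem ae_minPathDelay_le {p : P} {h : feasibleFlows t₀ tf od Q}
    (hΨ : ∀ t ∈ Set.Icc t₀ tf, 0 ≤ Ψ p t h) :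
    ∀ᵐ t ∂(dayMeasure t₀ tf), minPathDelay Ψ p h ≤ Ψ p t h :=
  ae_essInf_le ⟨0, by
    rw [Filter.eventually_map]
    filter_upwards [ae_restrict_mem measurableSet_Icc] with t ht using hΨ t ht⟩

/-- Real `essInf` is only conditionally defined; continuity on a compact interval supplies the upper
bound it needs here. -/
theorem le_minPathDelay (ht : t₀ < tf) {p : P} {h : feasibleFlows t₀ tf od Q}
    (hΨ : ContinuousOn (fun t => Ψ p t h) (Set.Icc t₀ tf)) {a : ℝ}
    (ha : ∀ t ∈ Set.Icc t₀ tf, a ≤ Ψ p t h) : a ≤ minPathDelay Ψ p h := by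
  have : NeZero (dayMeasure t₀ tf) := ⟨dayMeasure_ne_zero ht⟩
  obtain ⟨C, hC⟩ := isCompact_Icc.bddAbove_image hΨ
  have hcob : Filter.IsBoundedUnder (· ≤ ·) (ae (dayMeasure t₀ tf)) fun t => Ψ p t h := by
    refine ⟨C, ?_⟩
    rw [Filter.eventually_map]
    filter_upwards [ae_restrict_mem measurableSet_Icc] with t ht using
      hC (Set.mem_image_of_mem _ ht)
  refine le_essInf_of_ae_le a ?_ hcob.isCoboundedUnder_ge
  filter_upwards [ae_restrict_mem measurableSet_Icc] with t ht using ha t ht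

theorem minODDelay_le (p : P) (h : feasibleFlows t₀ tf od Q) :
    minODDelay Ψ (od p) h ≤ minPathDelay Ψ p h :=
  ciInf_le (f := fun q : {q : P // od q = od p} => minPathDelay Ψ q.1 h)
    (Set.finite_range _).bddBelow ⟨p, rfl⟩

theorem le_minODDelay {w : W} (hw : ∃ p, od p = w) {h : feasibleFlows t₀ tf od Q} {a : ℝ}
    (ha : ∀ p, od p = w → a ≤ minPathDelay Ψ p h) : a ≤ minODDelay Ψ w h :=
  have : Nonempty {p : P // od p = w} := let ⟨p, hp⟩ := hw; ⟨⟨p, hp⟩⟩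
  le_ciInf fun p => ha p.1 p.2

end

/-! ### Flows that are uniform on cells. -/

section StepFlow

variable {P : Type*} {t₀ tf : ℝ}

/-- The uniform density on the cell `J`. -/
noncomputable def uniformDensity (t₀ tf : ℝ) {J : Set ℝ} (hJ : MeasurableSet J) :
    Lp ℝ 2 (dayMeasure t₀ tf) :=
  indicatorConstLp 2 hJ (measure_ne_top (dayMeasure t₀ tf) J) ((dayMeasure t₀ tf).real J)⁻¹

/-- Cell averages are inner products with a fixed vector, hence continuous in the L² norm. -/
theorem inner_uniformDensity {J : Set ℝ} (hJ : MeasurableSet J)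
    (f : Lp ℝ 2 (dayMeasure t₀ tf)) :
    inner ℝ (uniformDensity t₀ tf hJ) f = ⨍ t in J, f t ∂(dayMeasure t₀ tf) := by
  rw [uniformDensity, L2.inner_indicatorConstLp_eq_inner_setIntegral, setAverage_eq]
  simp [mul_comm]

theorem uniformDensity_ae_eq {J : Set ℝ} (hJ : MeasurableSet J) :
    uniformDensity t₀ tf hJ =ᵐ[dayMeasure t₀ tf]
      J.indicator fun _ => ((dayMeasure t₀ tf).real J)⁻¹ :=
  indicatorConstLp_coeFn

theorem integral_uniformDensity {J : Set ℝ} (hJ : MeasurableSet J)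
    (hJ0 : dayMeasure t₀ tf J ≠ 0) :
    ∫ t, uniformDensity t₀ tf hJ t ∂(dayMeasure t₀ tf) = 1 := by
  rw [integral_congr_ae (uniformDensity_ae_eq hJ), integral_indicator_const _ hJ, smul_eq_mul]
  exact mul_inv_cancel₀ (ENNReal.toReal_pos hJ0 (measure_ne_top _ _)).ne'

variable {S : Type*} [Fintype S] {I : S → Set ℝ}

/-- The flow which sends the mass `x (p, k)` along the path `p`, uniformly over the cell `I k`. -/
noncomputable def stepFlow (t₀ tf : ℝ) (hI : ∀ k, MeasurableSet (I k))
    (x : EuclideanSpace ℝ (P × S)) : PathSpace P t₀ tf :=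
  WithLp.toLp 2 fun p => ∑ k, x (p, k) • uniformDensity t₀ tf (hI k)

theorem continuous_stepFlow (hI : ∀ k, MeasurableSet (I k)) :
    Continuous (stepFlow (P := P) t₀ tf hI) := by
  unfold stepFlow
  fun_prop

theorem stepFlow_ae_eq (hI : ∀ k, MeasurableSet (I k)) (x : EuclideanSpace ℝ (P × S)) (p : P) :
    stepFlow t₀ tf hI x p =ᵐ[dayMeasure t₀ tf]
      fun t => ∑ k, x (p, k) * uniformDensity t₀ tf (hI k) t := by
  refine (Lp.coeFn_finsetSum _ _).trans ?_
  have h : ∀ᵐ t ∂(dayMeasure t₀ tf), ∀ k : S,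
      (x (p, k) • uniformDensity t₀ tf (hI k) : Lp ℝ 2 _) t =
        x (p, k) * uniformDensity t₀ tf (hI k) t :=
    ae_all_iff.2 fun k => Lp.coeFn_smul _ _
  filter_upwards [h] with t ht
  rw [Finset.sum_apply]
  exact Finset.sum_congr rfl fun k _ => ht k

theorem stepFlow_nonneg (hI : ∀ k, MeasurableSet (I k)) {x : EuclideanSpace ℝ (P × S)}
    (hx : ∀ i, 0 ≤ x i) (p : P) : ∀ᵐ t ∂(dayMeasure t₀ tf), 0 ≤ stepFlow t₀ tf hI x p t := by
  filter_upwards [stepFlow_ae_eq hI x p,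
    ae_all_iff.2 fun k => uniformDensity_ae_eq (t₀ := t₀) (tf := tf) (hI k)] with t h1 h2
  rw [h1]
  refine Finset.sum_nonneg fun k _ => mul_nonneg (hx _) ?_
  rw [h2]
  exact Set.indicator_nonneg (fun _ _ => inv_nonneg.2 measureReal_nonneg) _

theorem exists_cell_of_stepFlow_pos (hI : ∀ k, MeasurableSet (I k))
    {x : EuclideanSpace ℝ (P × S)} (hx : ∀ i, 0 ≤ x i) (p : P) :
    ∀ᵐ t ∂(dayMeasure t₀ tf), 0 < stepFlow t₀ tf hI x p t → ∃ k, t ∈ I k ∧ 0 < x (p, k) := by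
  filter_upwards [stepFlow_ae_eq hI x p,
    ae_all_iff.2 fun k => uniformDensity_ae_eq (t₀ := t₀) (tf := tf) (hI k)] with t h1 h2 hpos
  rw [h1] at hpos
  obtain ⟨k, -, hk⟩ := Finset.exists_lt_of_sum_lt (f := fun _ => (0 : ℝ)) (by simpa using hpos)
  rw [h2] at hk
  refine ⟨k, ?_, (hx _).lt_of_ne' fun h => ?_⟩
  · by_contra h
    simp [h] at hk
  · simp [h] at hk

theorem integral_stepFlow (hI : ∀ k, MeasurableSet (I k)) (h0 : ∀ k, dayMeasure t₀ tf (I k) ≠ 0)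
    (x : EuclideanSpace ℝ (P × S)) (p : P) :
    ∫ t, stepFlow t₀ tf hI x p t ∂(dayMeasure t₀ tf) = ∑ k, x (p, k) := by
  rw [integral_congr_ae (stepFlow_ae_eq hI x p), integral_finsetSum]
  · simp_rw [integral_const_mul, integral_uniformDensity (hI _) (h0 _), mul_one]
  · exact fun k _ => ((Lp.memLp _).integrable one_le_two).const_mul _

theorem stepFlow_mem_feasibleFlows [Fintype P] {W : Type*} [DecidableEq W] {od : P → W} {Q : W → ℝ}
    (hI : ∀ k, MeasurableSet (I k)) (h0 : ∀ k, dayMeasure t₀ tf (I k) ≠ 0)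
    {x : EuclideanSpace ℝ (P × S)} (hx : ∀ i, 0 ≤ x i)
    (hxQ : ∀ w, ∑ i with od i.1 = w, x i = Q w) :
    stepFlow t₀ tf hI x ∈ feasibleFlows t₀ tf od Q := by
  refine ⟨stepFlow_nonneg hI hx, fun w => ?_⟩
  simp_rw [integral_stepFlow hI h0, ← hxQ w, Finset.sum_filter, Fintype.sum_prod_type]
  refine Finset.sum_congr rfl fun p _ => ?_
  split_ifs <;> simp

end StepFlow

/-! ### Existence of the equilibrium. -/

theorem mainTheorem5 {P W : Type*} [Fintype P] [Fintype W] [DecidableEq W]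
    (t₀ tf : ℝ) (ht : t₀ < tf)
    (od : P → W) (hod : Function.Surjective od)
    (Q : W → ℝ) (hQ : ∀ w, 0 ≤ Q w)
    (Ψ : P → ℝ → feasibleFlows t₀ tf od Q → ℝ)
    (hΨ_nonneg : ∀ p h, ∀ t ∈ Set.Icc t₀ tf, 0 ≤ Ψ p t h)
    (hΨ_memLp : ∀ p h, MemLp (fun t => Ψ p t h) 2 (dayMeasure t₀ tf))
    (hΨ_cont : Continuous (delayOperator Ψ hΨ_memLp))
    (hΨ_lip : ∀ p, ∃ L : NNReal, ∀ h, LipschitzOnWith L (fun t => Ψ p t h) (Set.Icc t₀ tf))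
    (ε : P → feasibleFlows t₀ tf od Q → ℝ)
    (hε : ∃ εmin : ℝ, 0 < εmin ∧ ∀ p h, εmin ≤ ε p h) :
    ∃ h : feasibleFlows t₀ tf od Q, IsVTBRDUE Ψ ε h := by
  obtain ⟨εmin, hεmin, hε⟩ := hε
  choose L₀ hL₀ using hΨ_lip
  let L : NNReal := ∑ p, L₀ p
  have hL : ∀ p h, LipschitzOnWith L (fun t => Ψ p t h) (Set.Icc t₀ tf) := fun p h =>
    (hL₀ p h).weaken (Finset.single_le_sum (fun _ _ => zero_le) (Finset.mem_univ p))
  -- The 2 counts the two averages compared below; `L + 1` avoids dividing by zero.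
  let η : ℝ := εmin / (2 * (L + 1))
  have hη : 0 < η := by positivity
  have hLη : 2 * (L * η) ≤ εmin := by
    have : 2 * ((L + 1) * η) = εmin := by simp only [η]; field_simp
    linarith
  obtain ⟨s, I, hIm, hIs, hI0, hId, hIc⟩ := exists_finite_cover_cells ht hη
  let J : s → Set ℝ := fun k => I k
  have hJ : ∀ k, MeasurableSet (J k) := fun k => hIm k
  have hJ0 : ∀ k, dayMeasure t₀ tf (J k) ≠ 0 := fun k => hI0 k k.2
  obtain ⟨k₀, hk₀, -⟩ := hIc t₀ ⟨le_rfl, ht.le⟩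
  let H : {x : EuclideanSpace ℝ (P × s) //
      (∀ i, 0 ≤ x i) ∧ ∀ w, ∑ i with od i.1 = w, x i = Q w} → feasibleFlows t₀ tf od Q :=
    fun x => ⟨stepFlow t₀ tf hJ x.1, stepFlow_mem_feasibleFlows hJ hJ0 x.2.1 x.2.2⟩
  have hH : Continuous H :=
    ((continuous_stepFlow hJ).comp continuous_subtype_val).subtype_mk _
  obtain ⟨x, hx⟩ := exists_finite_equilibrium (fun i : P × s => od i.1)
    (fun w => let ⟨p, hp⟩ := hod w; ⟨(p, ⟨k₀, hk₀⟩), hp⟩) Q hQ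
    (fun x => WithLp.toLp 2 fun i =>
      inner ℝ (uniformDensity t₀ tf (hJ i.2)) (delayOperator Ψ hΨ_memLp (H x) i.1))
    (by
      have hG : ∀ p, Continuous fun x => delayOperator Ψ hΨ_memLp (H x) p := fun p =>
        (PiLp.continuous_apply 2 _ p).comp (hΨ_cont.comp hH)
      exact (PiLp.continuous_toLp 2 _).comp
        (continuous_pi fun i => continuous_const.inner (hG i.1)))
  have hc : ∀ i : P × s, inner ℝ (uniformDensity t₀ tf (hJ i.2))
      (delayOperator Ψ hΨ_memLp (H x) i.1) =
        ⨍ t in J i.2, Ψ i.1 t (H x) ∂(dayMeasure t₀ tf) := fun i => by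
    rw [inner_uniformDensity, setAverage_eq, setAverage_eq]
    congr 1
    exact integral_congr_ae (ae_restrict_of_ae (hΨ_memLp i.1 (H x)).coeFn_toLp)
  simp only [hc] at hx
  have hav : ∀ p (k : s), ∀ t ∈ J k,
      |(⨍ t in J k, Ψ p t (H x) ∂(dayMeasure t₀ tf)) - Ψ p t (H x)| ≤ L * η :=
    fun p k t htk => abs_setAverage_sub_le (hL p (H x)) (hJ k) (hIs k) (hJ0 k) (hId k) htk
  refine ⟨H x, ?_⟩
  rintro _ p rfl
  filter_upwards [ae_minPathDelay_le (hΨ_nonneg p (H x)),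
    exists_cell_of_stepFlow_pos hJ x.2.1 p] with t hlow hpos hxt
  obtain ⟨k, htk, hk⟩ := hpos hxt
  refine ⟨(minODDelay_le p _).trans hlow, ?_⟩
  -- Pass from `t` to the average on its cell, by equilibrium to the average on the cell of `u`,
  -- then to `u` itself.
  have hle : Ψ p t (H x) - 2 * (L * η) ≤ minODDelay Ψ (od p) (H x) := by
    refine le_minODDelay ⟨p, rfl⟩ fun q hq =>
      le_minPathDelay ht (hL q (H x)).continuousOn fun u hu => ?_
    obtain ⟨l, hl, hul⟩ := hIc u hu
    have h1 := abs_le.1 (hav p k t htk)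
    have h2 := abs_le.1 (hav q ⟨l, hl⟩ u hul)
    have h3 := hx (p, k) (q, ⟨l, hl⟩) hq.symm hk
    dsimp only at h3
    linarith [h1.1, h2.2]
  linarith [hε p (H x)]
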